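/- Let $k$ be a field and let $G=(V,E,w)$ be a weighted DAG: $V$ is a set, $E\subseteq V\times V$ contains no pair $(v,v)$, $w:E\to(0,\infty)$, and whenever there is a path (a sequence of at least one edge, each starting where the previous one ends) from $a$ to $b$, there is none from $b$ to $a$. The length of a path is the sum of the weights of its edges. Let $F\subseteq E$ and let $S:F\to\bigsqcup_{d\in\mathbb N}\mathrm{int}(\Delta^d)$ be a subdivision; write $S(e)=(S(e)_0,\dots,S(e)_{d(e)})$, so that $S(e)_i>0$ and $\sum_i S(e)_i=1$. The subdivided weighted digraph $s_SG$ is obtained from $G$ by replacing each edge $e=(a,b)\in F$ by a chain of edges $a=v_{e,0}\to v_{e,1}\to\dots\to v_{e,d(e)}\to v_{e,d(e)+1}=b$ through $d(e)$ new vertices, where the edge $v_{e,i}\to v_{e,i+1}$ has weight $S(e)_i\,w(e)$; the edges outside $F$ and their weights are kept. For a weighted digraph $H$ the shortest-path filtration is the family $\mathrm{SP}(H)=(\mathrm{SP}(H)_t)_{t\ge 0}$ of digraphs on the vertex set of $H$ in which $i\to j$ (for $i\ne j$) is an edge of $\mathrm{SP}(H)_t$ if and only if there is a path from $i$ to $j$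 in $H$ of length at most $t$. The directed flag complex $\mathrm{dFl}(D)$ of a digraph $D$ consists of all directed cliques of $D$ (tuples $v_0\dots v_n$ of distinct vertices with $v_i\to v_j$ whenever $i<j$), and $H(\mathrm{dFl}(D))$ is its simplicial homology with coefficients in $k$, as a graded vector space. Thus $(H\circ\mathrm{dFl})(\mathrm{SP}(H))$ is a functor from the poset $[0,\infty)$ to graded $k$-vector spaces. A $\delta$-interleaving ($\delta\geq 0$) of two such functors $M,N$ is a pair of natural families of maps $f_t:M(t)\to N(t+\delta)$, $g_t:N(t)\to M(t+\delta)$ such that $g_{t+\delta}\circ f_t=M(t\le t+2\delta)$ and $f_{t+\delta}\circ g_t=N(t\le t+2\delta)$ for all $t\ge 0$, and $d_I(M,N)\in[0,\infty]$ is the infimum of all $\delta$ for which a $\delta$-interleaving exists. Then $$d_I\big((H\circ\mathrm{dFl})(\mathrm{SP}(G)),\,(H\circ\mathrm{dFl})(\mathrm{SP}(s_SG))\big)\;\le\;\sup_{e\in F}w(e),$$ where the supremum is taken in $[0,\infty]$ (it is the maximum if $F$ is finite and non-empty, and $0$ if $F=\emptyset$). -/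

import Mathlib

open CategoryTheory
open scoped NNReal ENNReal

universe u v w

noncomputable section

namespace DirectedFlag

/-! ### Elementary paths and the regular boundary map -/

/-- An elementary `n`-path `v₀ … vₙ` is irregular if two consecutive vertices agree. -/
def Irregular {V : Type u} {n : ℕ} (p : Fin (n + 1) → V) : Prop :=
  ∃ i : Fin n, p i.castSucc = p i.succ

section Paths

variable (k : Type v) [Field k]

/-- `Λₙ`: the free vector space on all elementary `n`-paths on `V`. -/
abbrev Lam (V : Type u) (n : ℕ) : Type (max u v) := (Fin (n + 1) → V) →₀ k

/-- The path `p` as a generator of `Λₙ`. -/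
def gen {V : Type u} {n : ℕ} (p : Fin (n + 1) → V) : Lam k V n := Finsupp.single p 1

/-- The non-regular boundary `v₀ … vₙ₊₁ ↦ ∑ᵢ (-1)ⁱ v₀ … v̂ᵢ … vₙ₊₁`. -/
def nregBd (V : Type u) (n : ℕ) : Lam k V (n + 1) →ₗ[k] Lam k V n :=
  Finsupp.linearCombination k
    (fun p => ∑ i : Fin (n + 2), (-1 : k) ^ (i : ℕ) • gen k (p ∘ i.succAbove))

theorem nregBd_gen {V : Type u} {n : ℕ} (p : Fin (n + 2) → V) :
    nregBd k V n (gen k p) =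
      ∑ i : Fin (n + 2), (-1 : k) ^ (i : ℕ) • gen k (p ∘ i.succAbove) := by
  simp [nregBd, gen]

theorem lam_ext {V : Type u} {n : ℕ} {M : Type w} [AddCommGroup M] [Module k M]
    {f g : Lam k V n →ₗ[k] M} (h : ∀ p, f (gen k p) = g (gen k p)) : f = g :=
  Finsupp.lhom_ext' fun p => LinearMap.ext_ring (h p)

theorem face_face {n : ℕ} (i : Fin (n + 3)) (j : Fin (n + 2)) (i' : Fin (n + 3))
    (j' : Fin (n + 2)) (h : (i : ℕ) ≤ j) (hi : (i' : ℕ) = j + 1) (hj : (j' : ℕ) = i) :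
    i.succAbove ∘ j.succAbove = i'.succAbove ∘ j'.succAbove := by
  funext l
  ext
  simp only [Function.comp_apply, Fin.succAbove, Fin.lt_def, Fin.val_castSucc]
  split_ifs <;> simp only [Fin.val_castSucc, Fin.val_succ] at * <;> omega

theorem nregBd_nregBd (V : Type u) (n : ℕ) :
    nregBd k V n ∘ₗ nregBd k V (n + 1) = 0 := by
  apply lam_ext
  intro p
  simp only [LinearMap.comp_apply, nregBd_gen, map_sum, map_smul, LinearMap.zero_apply,
    Finset.smul_sum, smul_smul]
  rw [← Finset.sum_product']
  refine Finset.sum_involution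
    (fun (x : Fin (n + 3) × Fin (n + 2)) _ =>
      if h : (x.1 : ℕ) ≤ x.2 then
        ((x.2.succ, ⟨x.1, by omega⟩) : Fin (n + 3) × Fin (n + 2))
      else (x.2.castSucc, ⟨x.1 - 1, by omega⟩)) ?_ ?_ ?_ ?_
  · rintro ⟨i, j⟩ -
    by_cases h : (i : ℕ) ≤ j
    · rw [dif_pos h]
      dsimp only
      rw [Function.comp_assoc, Function.comp_assoc, face_face i j j.succ ⟨i, by omega⟩ h
        (by simp) rfl, ← add_smul, Fin.val_succ]
      rw [show (-1 : k) ^ (i : ℕ) * (-1) ^ (j : ℕ) + (-1) ^ ((j : ℕ) + 1) * (-1) ^ (i : ℕ) = 0 by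
        ring, zero_smul]
    · rw [dif_neg h]
      dsimp only
      rw [Function.comp_assoc, Function.comp_assoc, ← face_face j.castSucc ⟨i - 1, by omega⟩ i j
        (by simp; omega) (by simp; omega) (by simp), ← add_smul, Fin.val_castSucc]
      obtain ⟨m, hm⟩ : ∃ m, (i : ℕ) = m + 1 := ⟨i - 1, by omega⟩
      have hz : (-1 : k) ^ (i : ℕ) * (-1) ^ (j : ℕ) + (-1) ^ (j : ℕ) * (-1) ^ ((i : ℕ) - 1) = 0 := by
        rw [hm, Nat.add_sub_cancel]
        ring
      rw [hz, zero_smul]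
  · rintro ⟨i, j⟩ - - h
    by_cases h' : (i : ℕ) ≤ j
    · rw [dif_pos h'] at h
      have := congrArg (fun x => (x.1 : ℕ)) h
      simp at this
      omega
    · rw [dif_neg h'] at h
      have := congrArg (fun x => (x.1 : ℕ)) h
      simp at this
      omega
  · intros
    simp
  · rintro ⟨i, j⟩ -
    by_cases h : (i : ℕ) ≤ j
    · have h2 : ¬ (j : ℕ) + 1 ≤ i := by omega
      simp [h, h2]
    · have h2 : (j : ℕ) ≤ i - 1 := by omega
      simp only [dif_neg h, Fin.val_castSucc, h2, dite_true]
      ext <;> simp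
      omega

/-- `𝓘ₙ`: the span of the irregular paths. -/
def irr (V : Type u) (n : ℕ) : Submodule k (Lam k V n) :=
  Submodule.span k {x | ∃ p : Fin (n + 1) → V, Irregular p ∧ x = gen k p}

theorem gen_mem_irr {V : Type u} {n : ℕ} {p : Fin (n + 1) → V} (hp : Irregular p) :
    gen k p ∈ irr k V n := Submodule.subset_span ⟨p, hp, rfl⟩

theorem nregBd_irr (V : Type u) (n : ℕ) :
    irr k V (n + 1) ≤ (irr k V n).comap (nregBd k V n) := by
  rw [irr, Submodule.span_le]
  rintro _ ⟨p, ⟨i, hi⟩, rfl⟩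
  simp only [SetLike.mem_coe, Submodule.mem_comap, nregBd_gen]
  have hne : i.castSucc ≠ i.succ := (Fin.castSucc_lt_succ (i := i)).ne
  rw [← Finset.add_sum_erase _ _ (Finset.mem_univ i.castSucc),
    ← Finset.add_sum_erase _ _ (Finset.mem_erase.2 ⟨hne.symm, Finset.mem_univ i.succ⟩),
    ← add_assoc]
  refine add_mem ?_ (Submodule.sum_mem _ fun j hj => Submodule.smul_mem _ _ ?_)
  · have : p ∘ i.castSucc.succAbove = p ∘ i.succ.succAbove := by
      funext l
      rcases lt_trichotomy (l : ℕ) i with h | h | h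
      · simp only [Function.comp_apply]
        rw [Fin.succAbove_of_castSucc_lt i.castSucc l h,
          Fin.succAbove_of_castSucc_lt i.succ l (Nat.lt_succ_of_lt h)]
      · obtain rfl : l = i := Fin.ext h
        simp [hi]
      · simp only [Function.comp_apply]
        rw [Fin.succAbove_of_le_castSucc i.castSucc l h.le,
          Fin.succAbove_of_le_castSucc i.succ l h]
    rw [this, ← add_smul, Fin.val_castSucc, Fin.val_succ, pow_succ, mul_neg_one, add_neg_cancel,
      zero_smul]
    exact zero_mem _
  · simp only [Finset.mem_erase, ne_eq, Fin.ext_iff, Fin.val_succ, Fin.val_castSucc] at hj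
    apply gen_mem_irr
    rcases lt_or_gt_of_ne hj.2.1 with h | h
    · refine ⟨⟨i - 1, by omega⟩, ?_⟩
      have e1 : j.succAbove (⟨i - 1, by omega⟩ : Fin n).castSucc = i.castSucc := by
        rw [Fin.succAbove_of_le_castSucc _ _ (by simp [Fin.le_def]; omega)]
        ext
        simp
        omega
      have e2 : j.succAbove (⟨i - 1, by omega⟩ : Fin n).succ = i.succ := by
        rw [Fin.succAbove_of_le_castSucc _ _ (by simp [Fin.le_def]; omega)]
        ext
        simp
        omega
      rw [Function.comp_apply, Function.comp_apply, e1, e2, hi]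
    · have h1 : (i : ℕ) < j := by omega
      have h2 : (i : ℕ) + 1 < j := by omega
      refine ⟨⟨i, by omega⟩, ?_⟩
      have e1 : j.succAbove (⟨i, by omega⟩ : Fin n).castSucc = i.castSucc := by
        rw [Fin.succAbove_of_castSucc_lt _ _ (by rw [Fin.lt_def]; exact h1)]
        ext
        simp
      have e2 : j.succAbove (⟨i, by omega⟩ : Fin n).succ = i.succ := by
        rw [Fin.succAbove_of_castSucc_lt _ _ (by rw [Fin.lt_def]; exact h2)]
        ext
        simp
      rw [Function.comp_apply, Function.comp_apply, e1, e2, hi]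

/-- `𝓡ₙ = Λₙ / 𝓘ₙ`; the regular paths form a basis and irregular paths are zero. -/
abbrev Reg (V : Type u) (n : ℕ) : Type (max u v) := Lam k V n ⧸ irr k V n

/-- The class of the path `p` in `𝓡ₙ`. -/
def rgen {V : Type u} {n : ℕ} (p : Fin (n + 1) → V) : Reg k V n := (irr k V n).mkQ (gen k p)

/-- The regular boundary map. -/
def bd (V : Type u) (n : ℕ) : Reg k V (n + 1) →ₗ[k] Reg k V n :=
  (irr k V (n + 1)).mapQ (irr k V n) (nregBd k V n) (nregBd_irr k V n)

theorem bd_bd (V : Type u) (n : ℕ) (x : Reg k V (n + 2)) :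
    bd k V n (bd k V (n + 1) x) = 0 := by
  obtain ⟨x, rfl⟩ := Submodule.mkQ_surjective _ x
  have := LinearMap.congr_fun (nregBd_nregBd k V n) x
  simp only [LinearMap.comp_apply, LinearMap.zero_apply] at this
  simp [bd, this]

/-- The map `Λₙ(f)` sending a path `p` to `f(p)`. -/
def lamMap {V : Type u} {W : Type u} (f : V → W) (n : ℕ) : Lam k V n →ₗ[k] Lam k W n :=
  Finsupp.lmapDomain k k (fun p => f ∘ p)

theorem lamMap_gen {V W : Type u} (f : V → W) {n : ℕ} (p : Fin (n + 1) → V) :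
    lamMap k f n (gen k p) = gen k (f ∘ p) := by
  simp [lamMap, gen]

theorem lamMap_irr {V W : Type u} (f : V → W) (n : ℕ) :
    irr k V n ≤ (irr k W n).comap (lamMap k f n) := by
  rw [irr, Submodule.span_le]
  rintro _ ⟨p, ⟨i, hi⟩, rfl⟩
  simp only [SetLike.mem_coe, Submodule.mem_comap, lamMap_gen]
  exact gen_mem_irr k ⟨i, by simp [hi]⟩

/-- The map `𝓡ₙ(f)`: it sends `p` to `f(p)` if `f(p)` is regular and to `0` otherwise. -/
def regMap {V W : Type u} (f : V → W) (n : ℕ) : Reg k V n →ₗ[k] Reg k W n :=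
  (irr k V n).mapQ (irr k W n) (lamMap k f n) (lamMap_irr k f n)

theorem regMap_rgen {V W : Type u} (f : V → W) {n : ℕ} (p : Fin (n + 1) → V) :
    regMap k f n (rgen k p) = rgen k (f ∘ p) := by
  simp [regMap, rgen, lamMap_gen]

theorem rgen_irregular {V : Type u} {n : ℕ} {p : Fin (n + 1) → V} (hp : Irregular p) :
    rgen k p = 0 := by
  simpa [rgen] using gen_mem_irr k hp

theorem reg_ext {V : Type u} {n : ℕ} {M : Type w} [AddCommGroup M] [Module k M]
    {f g : Reg k V n →ₗ[k] M} (h : ∀ p, f (rgen k p) = g (rgen k p)) : f = g :=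
  Submodule.linearMap_qext _ (lam_ext k h)

theorem bd_rgen {V : Type u} {n : ℕ} (p : Fin (n + 2) → V) :
    bd k V n (rgen k p) =
      ∑ i : Fin (n + 2), (-1 : k) ^ (i : ℕ) • rgen k (p ∘ i.succAbove) := by
  rw [bd, rgen, Submodule.mkQ_apply, Submodule.mapQ_apply, ← Submodule.mkQ_apply, nregBd_gen, map_sum]
  simp [rgen]

theorem bd_regMap {V W : Type u} (f : V → W) (n : ℕ) (x : Reg k V (n + 1)) :
    bd k W n (regMap k f (n + 1) x) = regMap k f n (bd k V n x) := by
  have : bd k W n ∘ₗ regMap k f (n + 1) = regMap k f n ∘ₗ bd k V n := by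
    apply reg_ext
    intro p
    simp [regMap_rgen, bd_rgen, Function.comp_assoc]
  exact LinearMap.congr_fun this x

theorem regMap_id (V : Type u) (n : ℕ) : regMap k (id : V → V) n = LinearMap.id := by
  apply reg_ext
  intro p
  simp [regMap_rgen]

theorem regMap_comp {V W X : Type u} (f : V → W) (g : W → X) (n : ℕ) :
    regMap k (g ∘ f) n = regMap k g n ∘ₗ regMap k f n := by
  apply reg_ext
  intro p
  simp [regMap_rgen, Function.comp_assoc]

end Paths

/-! ### Regular path complexes and their chain complexes -/

/-- A regular path complex on a vertex set. -/
structure RegPathComplex where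
  /-- the vertices -/
  V : Type u
  /-- the `n`-paths that belong to the complex -/
  paths : (n : ℕ) → Set (Fin (n + 1) → V)
  singleton_mem : ∀ p : Fin 1 → V, p ∈ paths 0
  tail_mem : ∀ (n : ℕ) (p : Fin (n + 2) → V), p ∈ paths (n + 1) → p ∘ Fin.succ ∈ paths n
  init_mem : ∀ (n : ℕ) (p : Fin (n + 2) → V), p ∈ paths (n + 1) → p ∘ Fin.castSucc ∈ paths n
  regular : ∀ (n : ℕ) (p : Fin (n + 1) → V), p ∈ paths n → ¬ Irregular p

namespace RegPathComplex

/-- Weak path morphisms. -/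
@[ext]
structure Hom (P Q : RegPathComplex.{u}) where
  toFun : P.V → Q.V
  weak : ∀ (n : ℕ) (p : Fin (n + 1) → P.V), p ∈ P.paths n →
    Irregular (toFun ∘ p) ∨ toFun ∘ p ∈ Q.paths n

instance : Category RegPathComplex.{u} where
  Hom := Hom
  id P := ⟨id, fun _ _ hp => Or.inr hp⟩
  comp f g := ⟨g.toFun ∘ f.toFun, fun n p hp => by
    rcases f.weak n p hp with ⟨i, hi⟩ | h
    · exact Or.inl ⟨i, congrArg g.toFun hi⟩
    · exact g.weak n _ h⟩

variable (k : Type v) [Field k]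

/-- `Cₙ(P)`: the subspace of `𝓡ₙ` spanned by the paths in `P`. -/
def C (P : RegPathComplex.{u}) (n : ℕ) : Submodule k (Reg k P.V n) :=
  Submodule.span k {x | ∃ p ∈ P.paths n, x = rgen k p}

/-- `Ωₙ(P) = {x ∈ Cₙ(P) | ∂ₙ x ∈ Cₙ₋₁(P)}`, with `∂₀ = 0`. -/
def Omega (P : RegPathComplex.{u}) : (n : ℕ) → Submodule k (Reg k P.V n)
  | 0 => P.C k 0
  | n + 1 => P.C k (n + 1) ⊓ (P.C k n).comap (bd k P.V n)

theorem Omega_le (P : RegPathComplex.{u}) (n : ℕ) : P.Omega k n ≤ P.C k n := by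
  cases n with
  | zero => exact le_rfl
  | succ n => exact inf_le_left

theorem bd_mem_Omega (P : RegPathComplex.{u}) (n : ℕ) (x : Reg k P.V (n + 1))
    (hx : x ∈ P.Omega k (n + 1)) : bd k P.V n x ∈ P.Omega k n := by
  cases n with
  | zero => exact hx.2
  | succ n =>
    refine ⟨hx.2, ?_⟩
    change bd k P.V n (bd k P.V (n + 1) x) ∈ P.C k n
    rw [bd_bd]
    exact zero_mem _

/-- The boundary map of `Ω(P)`. -/
def OmegaBd (P : RegPathComplex.{u}) (n : ℕ) : P.Omega k (n + 1) →ₗ[k] P.Omega k n :=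
  (bd k P.V n).restrict (P.bd_mem_Omega k n)

/-- The regular chain complex `Ω(P)`. -/
def chain (P : RegPathComplex.{u}) : ChainComplex (ModuleCat.{max u v} k) ℕ :=
  ChainComplex.of (fun n => ModuleCat.of k (P.Omega k n))
    (fun n => ModuleCat.ofHom (P.OmegaBd k n)) (fun n => by
      apply ModuleCat.hom_ext
      apply LinearMap.ext
      intro x
      exact Subtype.ext (bd_bd k P.V n x.1))

theorem chain_d (P : RegPathComplex.{u}) (n : ℕ) :
    (P.chain k).d (n + 1) n = ModuleCat.ofHom (P.OmegaBd k n) :=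
  ChainComplex.of_d (fun n => ModuleCat.of k (P.Omega k n))
    (fun n => ModuleCat.ofHom (P.OmegaBd k n)) n

theorem regMap_mem_C {P Q : RegPathComplex.{u}} (f : P ⟶ Q) (n : ℕ) (x : Reg k P.V n)
    (hx : x ∈ P.C k n) : regMap k f.toFun n x ∈ Q.C k n := by
  have : P.C k n ≤ (Q.C k n).comap (regMap k f.toFun n) := by
    rw [C, Submodule.span_le]
    rintro _ ⟨p, hp, rfl⟩
    simp only [SetLike.mem_coe, Submodule.mem_comap, regMap_rgen]
    rcases f.weak n p hp with h | h
    · rw [rgen_irregular k h]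
      exact zero_mem _
    · exact Submodule.subset_span ⟨_, h, rfl⟩
  exact this hx

theorem regMap_mem_Omega {P Q : RegPathComplex.{u}} (f : P ⟶ Q) (n : ℕ) (x : Reg k P.V n)
    (hx : x ∈ P.Omega k n) : regMap k f.toFun n x ∈ Q.Omega k n := by
  cases n with
  | zero => exact regMap_mem_C k f 0 x hx
  | succ n =>
    refine ⟨regMap_mem_C k f _ x hx.1, ?_⟩
    change bd k Q.V n (regMap k f.toFun (n + 1) x) ∈ Q.C k n
    rw [bd_regMap]
    exact regMap_mem_C k f _ _ hx.2

/-- The map `Ωₙ(f)`, the restriction of `𝓡ₙ(f)`. -/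
def OmegaMap {P Q : RegPathComplex.{u}} (f : P ⟶ Q) (n : ℕ) :
    P.Omega k n →ₗ[k] Q.Omega k n :=
  (regMap k f.toFun n).restrict (regMap_mem_Omega k f n)

/-- The functor `Ω` from regular path complexes with weak path morphisms to chain complexes. -/
def chainFunctor : RegPathComplex.{u} ⥤ ChainComplex (ModuleCat.{max u v} k) ℕ where
  obj P := P.chain k
  map {P Q} f := ChainComplex.ofHom (fun n => ModuleCat.ofHom (OmegaMap k f n))
    (fun n => by
      rw [chain_d, chain_d]
      apply ModuleCat.hom_ext
      apply LinearMap.ext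
      intro x
      exact Subtype.ext (bd_regMap k f.toFun n x.1))
  map_id P := by
    ext n : 1
    apply ModuleCat.hom_ext
    apply LinearMap.ext
    intro x
    exact Subtype.ext (LinearMap.congr_fun (regMap_id k P.V n) x.1)
  map_comp {P Q R} f g := by
    ext n : 1
    apply ModuleCat.hom_ext
    apply LinearMap.ext
    intro x
    exact Subtype.ext (LinearMap.congr_fun (regMap_comp k f.toFun g.toFun n) x.1)

end RegPathComplex

/-! ### Digraphs and the directed flag complex -/

/-- Simple digraphs: no self-loops, reciprocal edges allowed. -/
structure TcDgr where
  V : Type u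
  Adj : V → V → Prop
  loopless : ∀ v, ¬ Adj v v

namespace TcDgr

/-- Triangle-collapsing digraph maps. -/
@[ext]
structure Hom (G H : TcDgr.{u}) where
  toFun : G.V → H.V
  weak : ∀ a b, G.Adj a b → toFun a = toFun b ∨ H.Adj (toFun a) (toFun b)
  collapse : ∀ a b c, G.Adj a b → G.Adj a c → G.Adj b c →
    toFun a = toFun c → toFun a = toFun b ∧ toFun b = toFun c

instance : Category TcDgr.{u} where
  Hom := Hom
  id G := ⟨id, fun _ _ h => Or.inr h, fun a b c _ hac _ (h : a = c) =>
    absurd (h ▸ hac) (G.loopless _)⟩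
  comp {G H K} f g := ⟨g.toFun ∘ f.toFun, fun a b h => by
      rcases f.weak a b h with h | h
      · exact Or.inl (congrArg g.toFun h)
      · exact g.weak _ _ h, fun a b c hab hac hbc h => by
      rcases f.weak a c hac with h1 | h1
      · obtain ⟨h2, h3⟩ := f.collapse a b c hab hac hbc h1
        exact ⟨congrArg g.toFun h2, congrArg g.toFun h3⟩
      · rcases f.weak a b hab with h2 | h2
        · exact ⟨congrArg g.toFun h2, (congrArg g.toFun h2).symm.trans h⟩
        · rcases f.weak b c hbc with h3 | h3
          · exact ⟨h.trans (congrArg g.toFun h3).symm, congrArg g.toFun h3⟩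
          · exact g.collapse _ _ _ h2 h1 h3 h⟩

/-- `v₀ … vₙ` is a directed clique: distinct vertices with `vᵢ → vⱼ` whenever `i < j`. -/
def IsClique (G : TcDgr.{u}) {n : ℕ} (p : Fin (n + 1) → G.V) : Prop :=
  Function.Injective p ∧ ∀ i j, i < j → G.Adj (p i) (p j)

/-- The directed flag complex, as a regular path complex. -/
def dFl (G : TcDgr.{u}) : RegPathComplex.{u} where
  V := G.V
  paths _ := {p | G.IsClique p}
  singleton_mem p := ⟨fun i j _ => by omega, fun i j h => by omega⟩
  tail_mem _ p hp := ⟨hp.1.comp (Fin.succ_injective _), fun i j h =>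
    hp.2 _ _ (Fin.succ_lt_succ_iff.2 h)⟩
  init_mem _ p hp := ⟨hp.1.comp (Fin.castSucc_injective _), fun i j h =>
    hp.2 _ _ (Fin.castSucc_lt_castSucc_iff.2 h)⟩
  regular _ p hp := fun ⟨i, hi⟩ => absurd (hp.1 hi) (Fin.castSucc_lt_succ (i := i)).ne

theorem weak_dFl {G H : TcDgr.{u}} (f : G ⟶ H) (n : ℕ) (p : Fin (n + 1) → G.V)
    (hp : G.IsClique p) : Irregular (f.toFun ∘ p) ∨ H.IsClique (f.toFun ∘ p) := by
  by_cases hinj : Function.Injective (f.toFun ∘ p)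
  · refine Or.inr ⟨hinj, fun i j hij => ?_⟩
    rcases f.weak _ _ (hp.2 i j hij) with h | h
    · exact absurd (hinj h) hij.ne
    · exact h
  · left
    have : ∃ i j, i < j ∧ f.toFun (p i) = f.toFun (p j) := by
      simp only [Function.Injective, not_forall] at hinj
      obtain ⟨i, j, h, hne⟩ := hinj
      rcases lt_or_gt_of_ne hne with h' | h'
      · exact ⟨i, j, h', h⟩
      · exact ⟨j, i, h', h.symm⟩
    obtain ⟨i, j, hij, h⟩ := this
    have hi : i ≠ Fin.last n := (hij.trans_le (Fin.le_last j)).ne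
    obtain ⟨i, rfl⟩ := Fin.exists_castSucc_eq.2 hi
    refine ⟨i, ?_⟩
    rcases (Fin.castSucc_lt_iff_succ_le.1 hij).eq_or_lt with h' | h'
    · rw [Function.comp_apply, Function.comp_apply, h', h]
    · exact (f.collapse _ _ _ (hp.2 _ _ Fin.castSucc_lt_succ) (hp.2 _ _ hij)
        (hp.2 _ _ h') h).1

/-- The directed flag complex as a functor. -/
def dFlFunctor : TcDgr.{u} ⥤ RegPathComplex.{u} where
  obj := dFl
  map f := ⟨f.toFun, weak_dFl f⟩

/-- Homology of the directed flag complex with coefficients in `k`, in all degrees. -/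
def homology (k : Type v) [Field k] : TcDgr.{u} ⥤ GradedObject ℕ (ModuleCat.{max u v} k) :=
  dFlFunctor ⋙ RegPathComplex.chainFunctor k ⋙ HomologicalComplex.gradedHomologyFunctor _ _

end TcDgr

/-! ### Interleavings -/

section Interleaving

variable {C : Type u} [Category.{v} C]

/-- Translation `t ↦ t + δ` of the poset `[0, ∞)`. -/
def translate (δ : ℝ≥0) : ℝ≥0 ⥤ ℝ≥0 :=
  Monotone.functor (f := fun t => t + δ) fun _ _ h => add_le_add_left h δ

/-- A `δ`-interleaving of two persistent objects indexed by `[0, ∞)`. -/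
structure Interleaving (M N : ℝ≥0 ⥤ C) (δ : ℝ≥0) where
  f : M ⟶ translate δ ⋙ N
  g : N ⟶ translate δ ⋙ M
  fg : ∀ t : ℝ≥0, f.app t ≫ g.app (t + δ) =
    M.map (homOfLE (le_self_add.trans le_self_add : t ≤ t + δ + δ))
  gf : ∀ t : ℝ≥0, g.app t ≫ f.app (t + δ) =
    N.map (homOfLE (le_self_add.trans le_self_add : t ≤ t + δ + δ))

/-- The interleaving distance, in `[0, ∞]`. -/
def interleavingDist (M N : ℝ≥0 ⥤ C) : ℝ≥0∞ :=
  ⨅ (δ : ℝ≥0) (_ : Nonempty (Interleaving M N δ)), (δ : ℝ≥0∞)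

end Interleaving

/-! ### Weighted digraphs -/

/-- A simple digraph on `V` with positive edge weights. -/
structure WeightedDigraph (V : Type u) where
  E : Set (V × V)
  loopless : ∀ v, (v, v) ∉ E
  w : E → ℝ
  w_pos : ∀ e, 0 < w e

namespace WeightedDigraph

variable {V : Type u} (G : WeightedDigraph V)

/-- Paths `a ⇝ b`: sequences of at least one edge, each starting where the previous ends. -/
inductive Path : V → V → Type u
  | single {a b : V} (h : (a, b) ∈ G.E) : Path a b
  | cons {a b c : V} (h : (a, b) ∈ G.E) (p : Path b c) : Path a c

variable {G} in
/-- The sum of the weights of the edges of a path. -/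
def Path.length : {a b : V} → G.Path a b → ℝ
  | _, _, .single h => G.w ⟨_, h⟩
  | _, _, .cons h p => G.w ⟨_, h⟩ + p.length

/-- Directed acyclic: a path `a ⇝ b` excludes a path `b ⇝ a`. -/
def IsDAG : Prop := ∀ a b, Nonempty (G.Path a b) → ¬ Nonempty (G.Path b a)

/-- The digraph at scale `t` of the shortest-path filtration. The clause `a ≠ b` keeps it simple;
it is automatic when `G` is acyclic. -/
def spAt (t : ℝ) : TcDgr.{u} where
  V := V
  Adj a b := a ≠ b ∧ ∃ p : G.Path a b, p.length ≤ t
  loopless _ h := h.1 rfl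

/-- The shortest-path filtration, with the inclusions as structure maps. -/
def SP : ℝ≥0 ⥤ TcDgr.{u} where
  obj t := G.spAt t
  map {s t} h := ⟨id,
    fun _ _ hab => Or.inr ⟨hab.1, hab.2.imp fun _ hp =>
      hp.trans (NNReal.coe_le_coe.2 (leOfHom h))⟩,
    fun _ _ _ _ hac _ h => absurd h hac.1⟩

/-- The interior of the standard `d`-simplex. -/
def OpenSimplex (d : ℕ) : Type :=
  {x : Fin (d + 1) → ℝ // (∀ i, 0 < x i) ∧ ∑ i, x i = 1}

/-- A subdivision of `G`: a map from a set `F` of edges to `⊔_d int Δ^d`. -/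
structure Subdivision where
  F : Set G.E
  S : F → Σ d : ℕ, OpenSimplex d

namespace Subdivision

variable {G} (S : G.Subdivision)

/-- The number `d(e)` of new vertices on the edge `e`. -/
def d (e : S.F) : ℕ := (S.S e).1

/-- The barycentric coordinates `S(e)₀, …, S(e)_{d(e)}`. -/
def coord (e : S.F) (i : Fin (S.d e + 1)) : ℝ := (S.S e).2.1 i

/-- The vertices of the subdivided digraph: the old ones, and `d(e)` new ones for each `e ∈ F`. -/
abbrev Vert : Type u := V ⊕ Σ e : S.F, Fin (S.d e)

/-- `v_{e,0}, …, v_{e,d(e)+1}`: the start of `e`, its new vertices in order, and its end. -/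
def vert (e : S.F) : Fin (S.d e + 2) → S.Vert :=
  Fin.cons (Sum.inl e.1.1.1) (Fin.snoc (fun i => Sum.inr ⟨e, i⟩) (Sum.inl e.1.1.2))

/-- Index type of the edges: the old edges outside `F`, and `τ_{e,0}, …, τ_{e,d(e)}` for
`e ∈ F`. -/
abbrev EdgeIdx : Type u := {e : G.E // e ∉ S.F} ⊕ Σ e : S.F, Fin (S.d e + 1)

/-- The endpoints of an edge; `τ_{e,i} = (v_{e,i}, v_{e,i+1})`. -/
def ends : S.EdgeIdx → S.Vert × S.Vert
  | .inl e => (.inl e.1.1.1, .inl e.1.1.2)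
  | .inr ⟨e, i⟩ => (S.vert e i.castSucc, S.vert e i.succ)

/-- The weight of an edge. -/
def weight : S.EdgeIdx → ℝ
  | .inl e => G.w e.1
  | .inr ⟨e, i⟩ => S.coord e i * G.w e.1

theorem vert_zero (e : S.F) : S.vert e 0 = Sum.inl e.1.1.1 := rfl

theorem vert_mid (e : S.F) (i : Fin (S.d e)) : S.vert e i.castSucc.succ = Sum.inr ⟨e, i⟩ := by
  rw [vert, Fin.cons_succ, Fin.snoc_castSucc]

theorem vert_last (e : S.F) : S.vert e (Fin.last _).succ = Sum.inl e.1.1.2 := by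
  rw [vert, Fin.cons_succ, Fin.snoc_last]

theorem vert_begin (e : S.F) (i : Fin (S.d e + 1)) :
    (i = 0 ∧ S.vert e i.castSucc = Sum.inl e.1.1.1) ∨
      ∃ j : Fin (S.d e), i = j.succ ∧ S.vert e i.castSucc = Sum.inr ⟨e, j⟩ := by
  rcases Fin.eq_zero_or_eq_succ i with rfl | ⟨j, rfl⟩
  · exact Or.inl ⟨rfl, rfl⟩
  · exact Or.inr ⟨j, rfl, by rw [← Fin.succ_castSucc, vert_mid]⟩

theorem vert_finish (e : S.F) (i : Fin (S.d e + 1)) :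
    (i = Fin.last _ ∧ S.vert e i.succ = Sum.inl e.1.1.2) ∨
      ∃ j : Fin (S.d e), i = j.castSucc ∧ S.vert e i.succ = Sum.inr ⟨e, j⟩ := by
  rcases Fin.eq_castSucc_or_eq_last i with ⟨j, rfl⟩ | rfl
  · exact Or.inr ⟨j, rfl, S.vert_mid e j⟩
  · exact Or.inl ⟨rfl, S.vert_last e⟩

theorem ends_injective : Function.Injective S.ends := by
  rintro (e | ⟨e, i⟩) (e' | ⟨e', i'⟩) h
  · obtain ⟨h1, h2⟩ := Prod.mk.inj h
    exact congrArg Sum.inl (Subtype.ext (Subtype.ext (Prod.ext (Sum.inl.inj h1) (Sum.inl.inj h2))))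
  · exfalso
    obtain ⟨h1, h2⟩ := Prod.mk.inj h
    rcases S.vert_begin e' i' with ⟨-, h3⟩ | ⟨j, -, h3⟩ <;> rw [h3] at h1
    · rcases S.vert_finish e' i' with ⟨-, h4⟩ | ⟨j, -, h4⟩ <;> rw [h4] at h2
      · exact e.2 ((Subtype.ext (Prod.ext (Sum.inl.inj h1) (Sum.inl.inj h2)) : e.1 = e'.1) ▸ e'.2)
      · cases h2
    · cases h1
  · exfalso
    obtain ⟨h1, h2⟩ := Prod.mk.inj h
    rcases S.vert_begin e i with ⟨-, h3⟩ | ⟨j, -, h3⟩ <;> rw [h3] at h1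
    · rcases S.vert_finish e i with ⟨-, h4⟩ | ⟨j, -, h4⟩ <;> rw [h4] at h2
      · exact e'.2 ((Subtype.ext (Prod.ext (Sum.inl.inj h1) (Sum.inl.inj h2)) : e.1 = e'.1) ▸ e.2)
      · cases h2
    · cases h1
  · obtain ⟨h1, h2⟩ := Prod.mk.inj h
    rcases S.vert_begin e i with ⟨hi, h3⟩ | ⟨j, hi, h3⟩ <;>
      rcases S.vert_begin e' i' with ⟨hi', h3'⟩ | ⟨j', hi', h3'⟩ <;> rw [h3, h3'] at h1
    · rcases S.vert_finish e i with ⟨-, h4⟩ | ⟨j, hj, h4⟩ <;>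
        rcases S.vert_finish e' i' with ⟨-, h4'⟩ | ⟨j', hj', h4'⟩ <;> rw [h4, h4'] at h2
      · obtain rfl : e = e' :=
          Subtype.ext (Subtype.ext (Prod.ext (Sum.inl.inj h1) (Sum.inl.inj h2)))
        rw [hi, hi']
      · cases h2
      · cases h2
      · have h5 := Sum.inr.inj h2
        obtain rfl : e = e' := congrArg Sigma.fst h5
        rw [hi, hi']
    · cases h1
    · cases h1
    · have h5 := Sum.inr.inj h1
      obtain rfl : e = e' := congrArg Sigma.fst h5
      obtain rfl : j = j' := eq_of_heq (Sigma.mk.inj h5).2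
      rw [hi, hi']

theorem ends_ne (x : S.EdgeIdx) : (S.ends x).1 ≠ (S.ends x).2 := by
  rcases x with e | ⟨e, i⟩
  · intro h
    have h' : e.1.1.1 = e.1.1.2 := Sum.inl.inj h
    exact G.loopless e.1.1.1 ((Prod.ext rfl h' : (e.1.1.1, e.1.1.1) = e.1.1) ▸ e.1.2)
  · intro h
    change S.vert e i.castSucc = S.vert e i.succ at h
    rcases S.vert_begin e i with ⟨-, h3⟩ | ⟨j, hi, h3⟩ <;>
      rcases S.vert_finish e i with ⟨-, h4⟩ | ⟨j', hj, h4⟩ <;> rw [h3, h4] at h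
    · have h' : e.1.1.1 = e.1.1.2 := Sum.inl.inj h
      exact G.loopless e.1.1.1 ((Prod.ext rfl h' : (e.1.1.1, e.1.1.1) = e.1.1) ▸ e.1.2)
    · cases h
    · cases h
    · obtain rfl : j = j' := eq_of_heq (Sigma.mk.inj (Sum.inr.inj h)).2
      have := congrArg Fin.val (hi.symm.trans hj)
      simp at this

/-- The subdivided weighted digraph. -/
def subdivide : WeightedDigraph S.Vert where
  E := Set.range S.ends
  loopless v := fun ⟨x, hx⟩ => S.ends_ne x (by rw [hx])
  w e := S.weight ((Equiv.ofInjective S.ends S.ends_injective).symm e)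
  w_pos e := by
    rcases (Equiv.ofInjective S.ends S.ends_injective).symm e with e | ⟨e, i⟩
    · exact G.w_pos _
    · exact mul_pos ((S.S e).2.2.1 i) (G.w_pos _)

end Subdivision

end WeightedDigraph

end DirectedFlag

end

/-!
Sending each new vertex to the start of its edge retracts `s_S G` onto `G`. Give a vertex as offset
its distance from its image along the subdivided edge. A path of `s_S G` of length `L` from `x` to
`y` then retracts to a path of length `L + offset x - offset y`, so the retraction is a morphism of
shortest-path filtrations up to a shift by `sup w(e)`, while the inclusion of `G` preserves lengths.
Retracting and including again is joined to the identity by paths of length at most the offsets.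
In an acyclic digraph such a one-step homotopy makes every prism over a directed clique either a
directed clique or degenerate, so that the prism operator is a chain homotopy on the directed flag
complexes.
-/

noncomputable section

namespace DirectedFlag

section Prism

open Simplicial Opposite

section Paths

variable {V W : Type u} (φ ψ : V → W) {n : ℕ}

/-- The path `φ(p₀) … φ(pᵢ) ψ(pᵢ) … ψ(pₙ)`, one of the simplices that triangulate the prism over
`p` between `φ(p)` and `ψ(p)`. -/
def prismPath (i : Fin (n + 1)) (p : Fin (n + 1) → V) : Fin (n + 2) → W :=
  fun j => (if j ≤ i.castSucc then φ else ψ) (p (i.predAbove j))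

theorem prismPath_comp {m : ℕ} {i : Fin (n + 1)} {j : Fin (m + 1)} {η : Fin (m + 2) → Fin (n + 2)}
    {θ : Fin (m + 1) → Fin (n + 1)} (hside : ∀ l, η l ≤ i.castSucc ↔ l ≤ j.castSucc)
    (hindex : ∀ l, i.predAbove (η l) = θ (j.predAbove l)) (p : Fin (n + 1) → V) :
    prismPath φ ψ i p ∘ η = prismPath φ ψ j (p ∘ θ) := by
  funext l
  simp only [prismPath, Function.comp_apply, hside, hindex]

theorem prismPath_zero_comp_succAbove_zero (p : Fin (n + 1) → V) :
    prismPath φ ψ 0 p ∘ Fin.succAbove 0 = ψ ∘ p := by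
  funext l
  simp [prismPath]

theorem prismPath_last_comp_succAbove_last (p : Fin (n + 1) → V) :
    prismPath φ ψ (Fin.last n) p ∘ (Fin.last (n + 1)).succAbove = φ ∘ p := by
  funext l
  simp [prismPath, Fin.le_last]

theorem prismPath_succ_comp_succAbove {i : Fin (n + 2)} {j : Fin (n + 1)} (hij : i ≤ j.castSucc)
    (p : Fin (n + 2) → V) :
    prismPath φ ψ j.succ p ∘ i.castSucc.succAbove = prismPath φ ψ j (p ∘ i.succAbove) :=
  prismPath_comp φ ψ (by grind [Fin.succAbove])
    (by grind [Fin.predAbove, Fin.succAbove, Fin.coe_castPred]) p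

theorem prismPath_succ_comp_succAbove_self (j : Fin (n + 1)) (p : Fin (n + 2) → V) :
    prismPath φ ψ j.succ p ∘ j.castSucc.succ.succAbove =
      prismPath φ ψ j.castSucc p ∘ j.castSucc.succ.succAbove := by
  funext l
  grind [prismPath, Fin.predAbove, Fin.succAbove, Fin.coe_castPred]

theorem prismPath_castSucc_comp_succAbove {i : Fin (n + 2)} {j : Fin (n + 1)}
    (hji : j.castSucc < i) (p : Fin (n + 2) → V) :
    prismPath φ ψ j.castSucc p ∘ i.succ.succAbove = prismPath φ ψ j (p ∘ i.succAbove) :=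
  prismPath_comp φ ψ (by grind [Fin.succAbove])
    (by grind [Fin.predAbove, Fin.succAbove, Fin.coe_castPred]) p

theorem prismPath_comp_predAbove_castSucc {i j : Fin (n + 1)} (hij : i ≤ j)
    (p : Fin (n + 1) → V) :
    prismPath φ ψ j p ∘ i.castSucc.predAbove = prismPath φ ψ j.succ (p ∘ i.predAbove) :=
  prismPath_comp φ ψ (by grind [Fin.predAbove, Fin.coe_castPred])
    (by grind [Fin.predAbove, Fin.coe_castPred]) p

theorem prismPath_comp_predAbove_succ {i j : Fin (n + 1)} (hji : j ≤ i) (p : Fin (n + 1) → V) :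
    prismPath φ ψ j p ∘ i.succ.predAbove = prismPath φ ψ j.castSucc (p ∘ i.predAbove) :=
  prismPath_comp φ ψ (by grind [Fin.predAbove, Fin.coe_castPred])
    (by grind [Fin.predAbove, Fin.coe_castPred]) p

theorem irregular_prismPath {p : Fin (n + 1) → V} (hp : Irregular p) (i : Fin (n + 1)) :
    Irregular (prismPath φ ψ i p) := by
  obtain ⟨l, hl⟩ := hp
  rcases le_or_gt i l.castSucc with h | h
  · have hleft : i.predAbove l.succ.castSucc = l.castSucc := by grind [Fin.predAbove]
    have hright : i.predAbove l.succ.succ = l.succ := by grind [Fin.predAbove]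
    exact ⟨l.succ, by grind [prismPath]⟩
  · have hleft : i.predAbove l.castSucc.castSucc = l.castSucc := by
      grind [Fin.predAbove, Fin.coe_castPred]
    have hright : i.predAbove l.castSucc.succ = l.succ := by
      grind [Fin.predAbove, Fin.coe_castPred]
    exact ⟨l.castSucc, by grind [prismPath]⟩

end Paths

variable {V W : Type u}

/-- The simplicial set of all elementary paths on `V`. -/
def pathSet (V : Type u) : SimplicialObject (Type u) where
  obj n := Fin (n.unop.len + 1) → V
  map θ := ↾fun p => p ∘ θ.unop.toOrderHom

/-- The simplicial map `p ↦ f(p)`. -/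
def pathSetMap (f : V → W) : pathSet V ⟶ pathSet W where
  app _ := ↾fun p => f ∘ p

/-- The prisms over all paths, as a simplicial homotopy. -/
def prismHomotopy (φ ψ : V → W) :
    SimplicialObject.Homotopy (pathSetMap φ) (pathSetMap ψ) where
  h i := ↾prismPath φ ψ i
  h_zero_comp_δ_zero _ := by ext p; exact prismPath_zero_comp_succAbove_zero φ ψ p
  h_last_comp_δ_last _ := by ext p; exact prismPath_last_comp_succAbove_last φ ψ p
  h_succ_comp_δ_castSucc_of_lt _ _ hij := by
    ext p; exact prismPath_succ_comp_succAbove φ ψ hij p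
  h_succ_comp_δ_castSucc_succ j := by
    ext p; exact prismPath_succ_comp_succAbove_self φ ψ j p
  h_castSucc_comp_δ_succ_of_lt _ _ hji := by
    ext p; exact prismPath_castSucc_comp_succAbove φ ψ hji p
  h_comp_σ_castSucc_of_le _ _ hij := by
    ext p; exact prismPath_comp_predAbove_castSucc φ ψ hij p
  h_comp_σ_succ_of_lt _ _ hji := by
    ext p; exact prismPath_comp_predAbove_succ φ ψ hji p

variable (k : Type v) [Field k]

/-- The free `k`-module functor, with independent universes for the set and for `k`. -/
def freeModule : Type u ⥤ ModuleCat.{max u v} k where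
  obj X := ModuleCat.of k (X →₀ k)
  map f := ModuleCat.ofHom (Finsupp.lmapDomain k k f)
  map_id _ := ModuleCat.hom_ext (Finsupp.lmapDomain_id k k)
  map_comp f g := ModuleCat.hom_ext (Finsupp.lmapDomain_comp k k f g)

variable (V) in
/-- The non-regular chain complex `Λ_•`. -/
abbrev lamComplex : ChainComplex (ModuleCat.{max u v} k) ℕ :=
  (AlgebraicTopology.alternatingFaceMapComplex _).obj
    (((SimplicialObject.whiskering _ _).obj (freeModule k)).obj (pathSet V))

/-- The chain map `Λ_•(V) ⟶ Λ_•(W)` induced by `f`. -/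
abbrev lamComplexMap (f : V → W) : lamComplex V k ⟶ lamComplex W k :=
  (AlgebraicTopology.alternatingFaceMapComplex _).map
    (((SimplicialObject.whiskering _ _).obj (freeModule k)).map (pathSetMap f))

theorem nregBd_eq_sum (n : ℕ) :
    nregBd k V n = ∑ i : Fin (n + 2),
      (-1 : ℤ) ^ (i : ℕ) • Finsupp.lmapDomain k k fun p => p ∘ i.succAbove := by
  refine lam_ext k fun p => ?_
  rw [nregBd_gen, LinearMap.sum_apply]
  refine Finset.sum_congr rfl fun i _ => ?_
  simp [gen, ← Int.cast_smul_eq_zsmul k]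

theorem lamComplex_d (n : ℕ) :
    (lamComplex V k).d (n + 1) n = ModuleCat.ofHom (nregBd k V n) := by
  rw [nregBd_eq_sum, AlgebraicTopology.alternatingFaceMapComplex_obj_d]
  exact ModuleCat.hom_ext <| (ModuleCat.hom_sum ..).trans <|
    Finset.sum_congr rfl fun _ _ => ModuleCat.hom_zsmul ..

/-- The signed sum of the simplices of the prism over a path. -/
def lamPrism (φ ψ : V → W) (n : ℕ) : Lam k V n →ₗ[k] Lam k W (n + 1) :=
  ∑ i : Fin (n + 1), (-1 : ℤ) ^ (i : ℕ) • Finsupp.lmapDomain k k (prismPath φ ψ i)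

theorem lamPrism_gen (φ ψ : V → W) {n : ℕ} (p : Fin (n + 1) → V) :
    lamPrism k φ ψ n (gen k p) =
      ∑ i : Fin (n + 1), (-1 : ℤ) ^ (i : ℕ) • gen k (prismPath φ ψ i p) := by
  simp [lamPrism, gen]

/-- The chain homotopy given by the prisms. -/
abbrev lamHomotopy (φ ψ : V → W) : Homotopy (lamComplexMap k φ) (lamComplexMap k ψ) :=
  ((prismHomotopy φ ψ).whiskerRight (freeModule k)).toChainHomotopy

theorem lamHomotopy_hom (φ ψ : V → W) (n : ℕ) :
    (lamHomotopy k φ ψ).hom n (n + 1) = ModuleCat.ofHom (-lamPrism k φ ψ n) :=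
  (SimplicialObject.Homotopy.ToChainHomotopy.hom_eq _ n).trans <| ModuleCat.hom_ext <|
    congrArg Neg.neg <| (ModuleCat.hom_sum ..).trans <|
      Finset.sum_congr rfl fun _ _ => ModuleCat.hom_zsmul ..

theorem nregBd_lamPrism (φ ψ : V → W) (n : ℕ) :
    nregBd k W (n + 1) ∘ₗ lamPrism k φ ψ (n + 1) + lamPrism k φ ψ n ∘ₗ nregBd k V n =
      lamMap k ψ (n + 1) - lamMap k φ (n + 1) := by
  have hcomm := (lamHomotopy k φ ψ).comm (n + 1)
  rw [dNext_eq _ (i' := n) (by simp), prevD_eq _ (j' := n + 2) (by simp), lamHomotopy_hom,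
    lamHomotopy_hom, lamComplex_d, lamComplex_d] at hcomm
  have : lamMap k φ (n + 1) = (-lamPrism k φ ψ n) ∘ₗ nregBd k V n +
      nregBd k W (n + 1) ∘ₗ (-lamPrism k φ ψ (n + 1)) + lamMap k ψ (n + 1) :=
    congrArg ModuleCat.Hom.hom hcomm
  rw [this, LinearMap.neg_comp, LinearMap.comp_neg]
  abel

theorem nregBd_lamPrism_zero (φ ψ : V → W) :
    nregBd k W 0 ∘ₗ lamPrism k φ ψ 0 = lamMap k ψ 0 - lamMap k φ 0 := by
  have hcomm := (lamHomotopy k φ ψ).comm 0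
  rw [dNext_eq_zero _ _ (by simp), prevD_eq _ (j' := 1) (by simp), lamHomotopy_hom,
    lamComplex_d] at hcomm
  have : lamMap k φ 0 = 0 + nregBd k W 0 ∘ₗ (-lamPrism k φ ψ 0) + lamMap k ψ 0 :=
    congrArg ModuleCat.Hom.hom hcomm
  rw [this, LinearMap.comp_neg]
  abel

theorem lamPrism_irr (φ ψ : V → W) (n : ℕ) :
    irr k V n ≤ (irr k W (n + 1)).comap (lamPrism k φ ψ n) := by
  rw [irr, Submodule.span_le]
  rintro _ ⟨p, hp, rfl⟩
  rw [SetLike.mem_coe, Submodule.mem_comap, lamPrism_gen]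
  exact sum_mem fun i _ => zsmul_mem (gen_mem_irr k (irregular_prismPath φ ψ hp i)) _

/-- The prism operator on regular paths. -/
def regPrism (φ ψ : V → W) (n : ℕ) : Reg k V n →ₗ[k] Reg k W (n + 1) :=
  (irr k V n).mapQ (irr k W (n + 1)) (lamPrism k φ ψ n) (lamPrism_irr k φ ψ n)

theorem regPrism_rgen (φ ψ : V → W) {n : ℕ} (p : Fin (n + 1) → V) :
    regPrism k φ ψ n (rgen k p) =
      ∑ i : Fin (n + 1), (-1 : ℤ) ^ (i : ℕ) • rgen k (prismPath φ ψ i p) := by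
  refine (congrArg (irr k W (n + 1)).mkQ (lamPrism_gen k φ ψ p)).trans ?_
  simp only [map_sum, map_zsmul, rgen]

theorem bd_regPrism_zero (φ ψ : V → W) (x : Reg k V 0) :
    bd k W 0 (regPrism k φ ψ 0 x) = regMap k ψ 0 x - regMap k φ 0 x := by
  obtain ⟨x, rfl⟩ := Submodule.mkQ_surjective _ x
  exact congrArg (irr k W 0).mkQ (LinearMap.congr_fun (nregBd_lamPrism_zero k φ ψ) x)

theorem bd_regPrism (φ ψ : V → W) (n : ℕ) (x : Reg k V (n + 1)) :
    bd k W (n + 1) (regPrism k φ ψ (n + 1) x) + regPrism k φ ψ n (bd k V n x) =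
      regMap k ψ (n + 1) x - regMap k φ (n + 1) x := by
  obtain ⟨x, rfl⟩ := Submodule.mkQ_surjective _ x
  exact congrArg (irr k W (n + 1)).mkQ (LinearMap.congr_fun (nregBd_lamPrism k φ ψ n) x)

end Prism

namespace RegPathComplex

variable {P Q : RegPathComplex.{u}}

/-- The prisms from `f` to `g` over the paths of `P` are regular paths of `Q` or irregular. -/
def PrismCompatible (f g : P ⟶ Q) : Prop :=
  ∀ (n : ℕ) (p : Fin (n + 1) → P.V), p ∈ P.paths n → ∀ i : Fin (n + 1),
    Irregular (prismPath f.toFun g.toFun i p) ∨ prismPath f.toFun g.toFun i p ∈ Q.paths (n + 1)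

namespace PrismCompatible

variable {f g : P ⟶ Q} (k : Type v) [Field k]

theorem regPrism_mem_C (hfg : PrismCompatible f g) {n : ℕ} {x : Reg k P.V n} (hx : x ∈ P.C k n) :
    regPrism k f.toFun g.toFun n x ∈ Q.C k (n + 1) := by
  have : P.C k n ≤ (Q.C k (n + 1)).comap (regPrism k f.toFun g.toFun n) := by
    rw [C, Submodule.span_le]
    rintro _ ⟨p, hp, rfl⟩
    rw [SetLike.mem_coe, Submodule.mem_comap, regPrism_rgen]
    refine sum_mem fun i _ => zsmul_mem ?_ _
    rcases hfg n p hp i with h | h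
    · rw [rgen_irregular k h]
      exact zero_mem _
    · exact Submodule.subset_span ⟨_, h, rfl⟩
  exact this hx

theorem regPrism_mem_Omega (hfg : PrismCompatible f g) (n : ℕ) (x : Reg k P.V n)
    (hx : x ∈ P.Omega k n) : regPrism k f.toFun g.toFun n x ∈ Q.Omega k (n + 1) := by
  have hC := P.Omega_le k n hx
  refine ⟨hfg.regPrism_mem_C k hC, ?_⟩
  have hf := regMap_mem_C k f n x hC
  have hg := regMap_mem_C k g n x hC
  rw [SetLike.mem_coe, Submodule.mem_comap]
  cases n with
  | zero =>
    rw [bd_regPrism_zero]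
    exact sub_mem hg hf
  | succ n =>
    rw [eq_sub_of_add_eq (bd_regPrism k f.toFun g.toFun n x)]
    exact sub_mem (sub_mem hg hf) (hfg.regPrism_mem_C k hx.2)

/-- The restriction of the prism operator to `Ωₙ`. -/
def omegaPrism (hfg : PrismCompatible f g) (n : ℕ) : P.Omega k n →ₗ[k] Q.Omega k (n + 1) :=
  (regPrism k f.toFun g.toFun n).restrict (hfg.regPrism_mem_Omega k n)

/-- The components of the chain homotopy given by the prism operator. -/
def chainPrism (hfg : PrismCompatible f g) (i j : ℕ) (h : (ComplexShape.down ℕ).Rel j i) :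
    (P.chain k).X i ⟶ (Q.chain k).X j :=
  ModuleCat.ofHom (hfg.omegaPrism k i) ≫ eqToHom (congrArg (Q.chain k).X h)

theorem sub_eq_nullHomotopicMap (hfg : PrismCompatible f g) :
    (chainFunctor k).map g - (chainFunctor k).map f =
      Homotopy.nullHomotopicMap' (hfg.chainPrism k) := by
  ext n : 1
  cases n with
  | zero =>
    rw [Homotopy.nullHomotopicMap'_f_of_not_rel_left (k₁ := 1) (k₀ := 0) rfl (by simp)]
    rw [show (Q.chain k).d 1 0 = _ from chain_d k Q 0]
    apply ModuleCat.hom_ext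
    apply LinearMap.ext
    intro x
    exact Subtype.ext (bd_regPrism_zero k f.toFun g.toFun x.1).symm
  | succ n =>
    rw [Homotopy.nullHomotopicMap'_f (k₂ := n + 2) (k₁ := n + 1) (k₀ := n) rfl rfl]
    rw [chain_d k P n, show (Q.chain k).d (n + 2) (n + 1) = _ from chain_d k Q (n + 1)]
    apply ModuleCat.hom_ext
    apply LinearMap.ext
    intro x
    exact Subtype.ext ((bd_regPrism k f.toFun g.toFun n x.1).symm.trans (add_comm _ _))

/-- The chain homotopy given by the prism operator. -/
def homotopy (hfg : PrismCompatible f g) :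
    Homotopy ((chainFunctor k).map g) ((chainFunctor k).map f) :=
  Homotopy.equivSubZero.symm
    ((Homotopy.ofEq (hfg.sub_eq_nullHomotopicMap k)).trans (Homotopy.nullHomotopy' _))

end PrismCompatible

end RegPathComplex

namespace TcDgr

variable {P Q : TcDgr.{u}}

/-- No two vertices are joined by edges in both directions. -/
def Asymmetric (P : TcDgr.{u}) : Prop :=
  ∀ ⦃a b⦄, P.Adj a b → ¬ P.Adj b a

/-- Into an asymmetric digraph, the condition `collapse` on morphisms is automatic. -/
def Hom.ofAsymmetric (hQ : Q.Asymmetric) (f : P.V → Q.V)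
    (hf : ∀ a b, P.Adj a b → f a = f b ∨ Q.Adj (f a) (f b)) : Hom P Q where
  toFun := f
  weak := hf
  collapse a b c hab _ hbc h := by
    rcases hf a b hab with h1 | h1
    · exact ⟨h1, h1 ▸ h⟩
    · rcases hf b c hbc with h2 | h2
      · exact ⟨h.trans h2.symm, h2⟩
      · exact absurd (h ▸ h2) (hQ h1)

theorem irregular_or_isClique (hQ : Q.Asymmetric) {n : ℕ} (q : Fin (n + 1) → Q.V)
    (hq : ∀ i j, i < j → q i = q j ∨ Q.Adj (q i) (q j)) : Irregular q ∨ Q.IsClique q := by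
  refine or_iff_not_imp_left.2 fun hirr => ?_
  have hstep (l : Fin n) : q l.castSucc ≠ q l.succ := fun h => hirr ⟨l, h⟩
  have hne : ∀ i j, i < j → q i ≠ q j := by
    intro i j hij h
    obtain ⟨l, rfl⟩ := Fin.exists_castSucc_eq.2 (hij.trans_le (Fin.le_last j)).ne
    rcases (Fin.castSucc_lt_iff_succ_le.1 hij).eq_or_lt with rfl | hlj
    · exact hstep l h
    · have hout := (hq _ _ Fin.castSucc_lt_succ).resolve_left (hstep l)
      have hback := (hq _ _ hlj).resolve_left fun h' => hstep l (h.trans h'.symm)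
      exact hQ hout (h ▸ hback)
  exact ⟨.of_lt_imp_ne hne, fun i j hij => (hq i j hij).resolve_left (hne i j hij)⟩

/-- A one-step homotopy `f ⇒ g`: whenever `x = y` or `x → y`, either `f x = g y` or
`f x → g y`. -/
structure StepHomotopic (f g : P ⟶ Q) : Prop where
  vertex : ∀ x, f.toFun x = g.toFun x ∨ Q.Adj (f.toFun x) (g.toFun x)
  edge : ∀ x y, P.Adj x y → f.toFun x = g.toFun y ∨ Q.Adj (f.toFun x) (g.toFun y)

namespace StepHomotopic

variable {f g : P ⟶ Q}

theorem prismCompatible (hfg : StepHomotopic f g) (hQ : Q.Asymmetric) :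
    RegPathComplex.PrismCompatible (dFlFunctor.map f) (dFlFunctor.map g) := by
  intro n p hp i
  refine irregular_or_isClique hQ (prismPath f.toFun g.toFun i p) fun a b hab => ?_
  have hle : i.predAbove a ≤ i.predAbove b := Fin.predAbove_right_monotone i hab.le
  unfold prismPath
  rcases hle.eq_or_lt with heq | hlt
  · rw [heq]
    split_ifs with ha hb hb
    · exact Or.inl rfl
    · exact hfg.vertex _
    · exact absurd (hab.le.trans hb) ha
    · exact Or.inl rfl
  · have hadj := hp.2 _ _ hlt
    split_ifs with ha hb hb
    · exact f.weak _ _ hadj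
    · exact hfg.edge _ _ hadj
    · exact absurd (hab.le.trans hb) ha
    · exact g.weak _ _ hadj

theorem homology_map_eq (hfg : StepHomotopic f g) (hQ : Q.Asymmetric) (k : Type v) [Field k] :
    (homology k).map f = (homology k).map g := by
  funext n
  exact (((hfg.prismCompatible hQ).homotopy k).homologyMap_eq n).symm

end StepHomotopic

end TcDgr

namespace WeightedDigraph

variable {V W : Type u} {G : WeightedDigraph V} {H : WeightedDigraph W}

/-- Concatenation of paths. -/
def Path.append : {a b c : V} → G.Path a b → G.Path b c → G.Path a c
  | _, _, _, .single h, q => .cons h q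
  | _, _, _, .cons h p, q => .cons h (p.append q)

theorem Path.length_append {a b c : V} (p : G.Path a b) (q : G.Path b c) :
    (p.append q).length = p.length + q.length := by
  induction p with
  | single h => rfl
  | cons h p ih => simp only [append, length, ih, add_assoc]

theorem Path.length_pos {a b : V} (p : G.Path a b) : 0 < p.length := by
  induction p with
  | single h => exact G.w_pos _
  | cons h p ih => exact add_pos (G.w_pos _) ih

theorem IsDAG.ne (hG : G.IsDAG) {a b : V} (p : G.Path a b) : a ≠ b := by
  rintro rfl
  exact hG a a ⟨p⟩ ⟨p⟩

theorem IsDAG.spAt_asymmetric (hG : G.IsDAG) (t : ℝ) : (G.spAt t).Asymmetric :=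
  fun a b h h' => hG a b ⟨h.2.choose⟩ ⟨h'.2.choose⟩

variable (G) in
/-- `b` is reached from `a` by a possibly empty path of length exactly `L`. -/
def Reaches (a b : V) (L : ℝ) : Prop :=
  (a = b ∧ L = 0) ∨ ∃ p : G.Path a b, p.length = L

namespace Reaches

variable {a b c : V} {L M t : ℝ}

theorem refl (a : V) : G.Reaches a a 0 := Or.inl ⟨rfl, rfl⟩

theorem edge (e : G.E) : G.Reaches e.1.1 e.1.2 (G.w e) := Or.inr ⟨.single e.2, rfl⟩

theorem path (p : G.Path a b) : G.Reaches a b p.length := Or.inr ⟨p, rfl⟩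

theorem trans (h : G.Reaches a b L) (h' : G.Reaches b c M) : G.Reaches a c (L + M) := by
  rcases h with ⟨rfl, rfl⟩ | ⟨p, rfl⟩
  · rwa [zero_add]
  · rcases h' with ⟨rfl, rfl⟩ | ⟨q, rfl⟩
    · rw [add_zero]
      exact path p
    · rw [← p.length_append q]
      exact path (p.append q)

theorem nonneg (h : G.Reaches a b L) : 0 ≤ L := by
  rcases h with ⟨-, rfl⟩ | ⟨p, rfl⟩
  exacts [le_rfl, p.length_pos.le]

theorem eq_or_adj (h : G.Reaches a b L) (hG : G.IsDAG) (hL : L ≤ t) :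
    a = b ∨ (G.spAt t).Adj a b :=
  h.imp And.left fun ⟨p, hp⟩ => ⟨hG.ne p, p, hp.trans_le hL⟩

end Reaches

variable (G H) in
/-- `f` carries each edge `a → b` of `G` to a possibly empty path of `H` that is longer by
`φ a - φ b`. The potential `φ` makes these discrepancies telescope along a path. -/
def CarriesEdges (f : V → W) (φ : V → ℝ) : Prop :=
  ∀ e : G.E, H.Reaches (f e.1.1) (f e.1.2) (G.w e + φ e.1.1 - φ e.1.2)

namespace CarriesEdges

variable {f : V → W} {φ : V → ℝ}

theorem reaches_map (hf : CarriesEdges G H f φ) {a b : V} (p : G.Path a b) :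
    H.Reaches (f a) (f b) (p.length + φ a - φ b) := by
  induction p with
  | single h => exact hf ⟨_, h⟩
  | cons h p ih =>
    convert (hf ⟨_, h⟩).trans ih using 1
    simp only [Path.length]
    ring

theorem isDAG (hf : CarriesEdges G H f φ) (hH : H.IsDAG) : G.IsDAG := by
  rintro a b ⟨p⟩ ⟨q⟩
  have hcycle := hf.reaches_map (p.append q)
  rw [add_sub_cancel_right] at hcycle
  rcases hcycle with ⟨-, h⟩ | ⟨r, -⟩
  · exact (p.append q).length_pos.ne' h
  · exact hH.ne r rfl

/-- The morphism of shortest-path filtrations, shifted by `δ`, induced by a map that carries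
edges to paths. -/
def spMap (hf : CarriesEdges G H f φ) (hH : H.IsDAG) {δ : ℝ≥0} (hφ : ∀ a b, φ a - φ b ≤ δ) :
    G.SP ⟶ translate δ ⋙ H.SP where
  app t := TcDgr.Hom.ofAsymmetric (hH.spAt_asymmetric _) f fun a b ⟨_, p, hp⟩ =>
    (hf.reaches_map p).eq_or_adj hH <| by
      rw [add_sub_assoc]
      exact add_le_add hp (hφ a b)
  naturality _ _ _ := rfl

end CarriesEdges

variable (G H) in
/-- `G` as a deformation retract of `H`: the inclusion preserves lengths, and the retraction
moves each vertex `y` backwards along a path of length `offset y`, changing lengths accordingly. -/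
structure DeformationRetract where
  incl : V → W
  ret : W → V
  offset : W → ℝ
  ret_incl : ∀ a, ret (incl a) = a
  carriesEdges_incl : CarriesEdges G H incl 0
  carriesEdges_ret : CarriesEdges H G ret offset
  reaches_incl_ret : ∀ y, H.Reaches (incl (ret y)) y (offset y)

namespace DeformationRetract

theorem isDAG (R : DeformationRetract G H) (hG : G.IsDAG) : H.IsDAG :=
  R.carriesEdges_ret.isDAG hG

variable (R : DeformationRetract G H) (hG : G.IsDAG) {δ : ℝ≥0} (hδ : ∀ y, R.offset y ≤ δ)

/-- The inclusion on shortest-path filtrations. -/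
def spIncl (δ : ℝ≥0) : G.SP ⟶ translate δ ⋙ H.SP :=
  R.carriesEdges_incl.spMap (R.isDAG hG) fun _ _ => by simp

/-- The retraction on shortest-path filtrations. -/
def spRet : H.SP ⟶ translate δ ⋙ G.SP :=
  R.carriesEdges_ret.spMap hG fun x y =>
    (sub_le_self _ (R.reaches_incl_ret y).nonneg).trans (hδ x)

theorem spIncl_spRet (t : ℝ≥0) :
    (R.spIncl hG δ).app t ≫ (R.spRet hG hδ).app (t + δ) =
      G.SP.map (homOfLE (le_self_add.trans le_self_add : t ≤ t + δ + δ)) :=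
  TcDgr.Hom.ext (funext R.ret_incl)

theorem spRet_spIncl_stepHomotopic (t : ℝ≥0) :
    TcDgr.StepHomotopic ((R.spRet hG hδ).app t ≫ (R.spIncl hG δ).app (t + δ))
      (H.SP.map (homOfLE (le_self_add.trans le_self_add : t ≤ t + δ + δ))) where
  vertex y := (R.reaches_incl_ret y).eq_or_adj (R.isDAG hG) <|
    (hδ y).trans (NNReal.coe_le_coe.2 le_add_self)
  edge x _ := fun ⟨_, p, hp⟩ =>
    ((R.reaches_incl_ret x).trans (.path p)).eq_or_adj (R.isDAG hG) <| calc
      R.offset x + p.length ≤ δ + t := add_le_add (hδ x) hp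
      _ = (t + δ : ℝ≥0) := add_comm _ _
      _ ≤ (t + δ + δ : ℝ≥0) := NNReal.coe_le_coe.2 le_self_add

/-- The interleaving of persistent homologies given by the inclusion and the retraction. -/
def interleaving (k : Type v) [Field k] :
    Interleaving (G.SP ⋙ TcDgr.homology k) (H.SP ⋙ TcDgr.homology k) δ where
  f := Functor.whiskerRight (R.spIncl hG δ) (TcDgr.homology k)
  g := Functor.whiskerRight (R.spRet hG hδ) (TcDgr.homology k)
  fg t := ((TcDgr.homology k).map_comp _ _).symm.trans
    (congrArg (TcDgr.homology k).map (R.spIncl_spRet hG hδ t))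
  gf t := ((TcDgr.homology k).map_comp _ _).symm.trans
    ((R.spRet_spIncl_stepHomotopic hG hδ t).homology_map_eq ((R.isDAG hG).spAt_asymmetric _) k)

end DeformationRetract

namespace Subdivision

variable (S : G.Subdivision)

theorem coord_pos (e : S.F) (i : Fin (S.d e + 1)) : 0 < S.coord e i := (S.S e).2.2.1 i

/-- The distance of `v_{e,i}` from the start of `e`, measured along `e`. -/
def position (e : S.F) : Fin (S.d e + 2) → ℝ :=
  Fin.partialSum fun i => S.coord e i * G.w e

theorem position_zero (e : S.F) : S.position e 0 = 0 := Fin.partialSum_zero _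

theorem position_succ (e : S.F) (i : Fin (S.d e + 1)) :
    S.position e i.succ = S.position e i.castSucc + S.coord e i * G.w e :=
  Fin.partialSum_succ _ i

theorem position_last (e : S.F) : S.position e (Fin.last _) = G.w e := by
  have hsum : ∑ i, S.coord e i = 1 := (S.S e).2.2.2
  rw [position, Fin.partialSum, Fin.val_last, List.take_of_length_le (List.length_ofFn).le,
    List.sum_ofFn, ← Finset.sum_mul, hsum, one_mul]

theorem position_le (e : S.F) (i : Fin (S.d e + 2)) : S.position e i ≤ G.w e := by
  have hmono : Monotone (S.position e) := Fin.monotone_iff_le_succ.2 fun i => by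
    rw [position_succ]
    exact le_add_of_nonneg_right (mul_pos (S.coord_pos e i) (G.w_pos _)).le
  exact (hmono (Fin.le_last i)).trans_eq (S.position_last e)

theorem subdivide_w_ends (x : S.EdgeIdx) : S.subdivide.w ⟨S.ends x, x, rfl⟩ = S.weight x :=
  congrArg S.weight ((Equiv.ofInjective S.ends S.ends_injective).symm_apply_apply x)

theorem reaches_ends (x : S.EdgeIdx) :
    S.subdivide.Reaches (S.ends x).1 (S.ends x).2 (S.weight x) := by
  rw [← subdivide_w_ends]
  exact .edge (G := S.subdivide) ⟨S.ends x, x, rfl⟩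

theorem reaches_vert (e : S.F) (i : Fin (S.d e + 2)) :
    S.subdivide.Reaches (.inl e.1.1.1) (S.vert e i) (S.position e i) := by
  induction i using Fin.induction with
  | zero =>
    rw [position_zero]
    exact .refl _
  | succ i ih =>
    rw [position_succ]
    exact ih.trans (S.reaches_ends (.inr ⟨e, i⟩))

theorem carriesEdges_inl : CarriesEdges G S.subdivide .inl 0 := by
  intro e
  rw [Pi.zero_apply, Pi.zero_apply, add_zero, sub_zero]
  by_cases he : e ∈ S.F
  · have := S.reaches_vert ⟨e, he⟩ (Fin.last _)
    rwa [position_last, ← Fin.succ_last, vert_last] at this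
  · exact S.reaches_ends (.inl ⟨e, he⟩)

/-- The retraction sending each new vertex to the start of its edge. -/
def retract : S.Vert → V
  | .inl v => v
  | .inr x => x.1.1.1.1

/-- The distance of a vertex from its retraction along the subdivided edge. -/
def offset : S.Vert → ℝ
  | .inl _ => 0
  | .inr x => S.position x.1 x.2.castSucc.succ

theorem offset_le {δ : ℝ≥0} (hδ : ∀ e : S.F, G.w e ≤ δ) (x : S.Vert) : S.offset x ≤ δ := by
  rcases x with _ | x
  · exact δ.2
  · exact (S.position_le _ _).trans (hδ _)

theorem retract_vert_castSucc (e : S.F) (i : Fin (S.d e + 1)) :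
    S.retract (S.vert e i.castSucc) = e.1.1.1 := by
  rcases S.vert_begin e i with ⟨-, h⟩ | ⟨j, -, h⟩ <;> rw [h] <;> rfl

theorem offset_vert_castSucc (e : S.F) (i : Fin (S.d e + 1)) :
    S.offset (S.vert e i.castSucc) = S.position e i.castSucc := by
  rcases S.vert_begin e i with ⟨rfl, h⟩ | ⟨j, rfl, h⟩ <;> rw [h]
  · exact (S.position_zero e).symm
  · rfl

theorem reaches_inl_retract (x : S.Vert) :
    S.subdivide.Reaches (.inl (S.retract x)) x (S.offset x) := by
  rcases x with v | ⟨e, i⟩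
  · exact .refl _
  · have := S.reaches_vert e i.castSucc.succ
    rwa [vert_mid] at this

/-- All edges of the chain replacing `e` are collapsed by the retraction except the last one,
which is carried to `e`. -/
theorem reaches_retract_ends (x : S.EdgeIdx) :
    G.Reaches (S.retract (S.ends x).1) (S.retract (S.ends x).2)
      (S.weight x + S.offset (S.ends x).1 - S.offset (S.ends x).2) := by
  rcases x with e | ⟨e, i⟩
  · simpa only [ends, weight, offset, retract, add_zero, sub_zero] using Reaches.edge e.1
  · simp only [ends, weight]
    rw [retract_vert_castSucc, offset_vert_castSucc, add_comm (S.coord e i * G.w e),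
      ← position_succ]
    rcases S.vert_finish e i with ⟨rfl, h⟩ | ⟨j, rfl, h⟩ <;> rw [h]
    · rw [Fin.succ_last, position_last]
      simpa only [offset, retract, sub_zero] using Reaches.edge e.1
    · simpa only [offset, retract, sub_self] using Reaches.refl _

theorem carriesEdges_retract : CarriesEdges S.subdivide G S.retract S.offset := by
  rintro ⟨_, x, rfl⟩
  rw [subdivide_w_ends]
  exact S.reaches_retract_ends x

/-- The old vertices as a deformation retract of the subdivided digraph. -/
def deformationRetract : DeformationRetract G S.subdivide where
  incl := .inl
  ret := S.retract
  offset := S.offset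
  ret_incl _ := rfl
  carriesEdges_incl := S.carriesEdges_inl
  carriesEdges_ret := S.carriesEdges_retract
  reaches_incl_ret := S.reaches_inl_retract

end Subdivision

end WeightedDigraph

end DirectedFlag

end

theorem mainTheorem4 {k : Type v} [Field k] {V : Type u}
    (G : DirectedFlag.WeightedDigraph V) (hG : G.IsDAG) (S : G.Subdivision) :
    DirectedFlag.interleavingDist
        (G.SP ⋙ DirectedFlag.TcDgr.homology k)
        (S.subdivide.SP ⋙ DirectedFlag.TcDgr.homology k)
      ≤ ⨆ e : S.F, ENNReal.ofReal (G.w e) := by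
  rcases eq_or_ne (⨆ e : S.F, ENNReal.ofReal (G.w e)) ⊤ with htop | hfin
  · exact htop ▸ le_top
  · obtain ⟨δ, hδ⟩ := ENNReal.canLift.prf _ hfin
    rw [← hδ]
    have hw (e : S.F) : G.w e ≤ δ := by
      have he : ENNReal.ofReal (G.w e) ≤ δ := hδ ▸ le_iSup (fun e : S.F => ENNReal.ofReal (G.w e)) e
      exact Real.toNNReal_le_iff_le_coe.1 (ENNReal.coe_le_coe.1 he)
    exact iInf₂_le δ ⟨S.deformationRetract.interleaving hG (S.offset_le hw) k⟩
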